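/- **Theorem (Local Asymptotic Stability).** Let $N$ be the number of streamers, let $\alpha_i,p_i,\eta_i$ ($1\le i\le N$) and $\beta,M,\tau,R,\gamma$ be real parameters, let $Q\subseteq\mathbb R$ be the open set of admissible quality levels, and let the cost function $c:Q\to\mathbb R$ be twice continuously differentiable. For $n=(n_1,\dots,n_N)\in\mathbb R^N$ (viewer numbers) and $q=(q_1,\dots,q_N)\in Q^N$ (content qualities) put $$P_i(n,q)=\frac{\exp(\alpha_i q_i-p_i+\beta n_i)}{\sum_{k=1}^N\exp(\alpha_k q_k-p_k+\beta n_k)},$$ and consider on $\mathbb R^N\times Q^N$ the system $$\frac{dn_i}{dt}=\gamma\bigl[M P_i(n,q)-n_i\bigr],\qquad \frac{dq_i}{dt}=\eta_i\Bigl[(1-\tau)R\,\frac{\partial (M P_i)}{\partial q_i}(n,q)-c'(q_i)\Bigr],\qquad 1\le i\le N,$$ where the partial derivative is taken with $n$ and all $q_k$, $k\ne i$, fixed (so it equals $M\alpha_iP_i(1-P_i)$). Let $(n^*,q^*)\in\mathbb R^N\times Q^N$ be a steady state, i.e. a zero of the right-hand side, and let $J$ be the $2N\times 2N$ Jacobian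 matrix of the right-hand side with respect to $(n,q)$, evaluated at $(n^*,q^*)$. If every complex eigenvalue $\lambda$ of $J$ satisfies $\operatorname{Re}\lambda<0$, then $(n^*,q^*)$ is locally asymptotically stable: every initial value sufficiently close to $(n^*,q^*)$ has a solution defined for all $t\ge 0$; for every $\varepsilon>0$ there is $\delta>0$ such that every solution on an interval $[0,T)$ that starts within distance $\delta$ of $(n^*,q^*)$ stays within distance $\varepsilon$ of it; and there is $\delta>0$ such that every solution on $[0,\infty)$ that starts within distance $\delta$ of $(n^*,q^*)$ converges to it as $t\to\infty$. -/

import Mathlib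

/-- `x` is a solution on the time set `s` of the autonomous ODE `x' = F x` posed on the domain
`D`: it stays in `D` and solves the equation (one-sided derivatives at end points of `s`). -/
def IsODESolutionOn {E : Type*} [NormedAddCommGroup E] [NormedSpace ℝ E]
    (F : E → E) (D : Set E) (x : ℝ → E) (s : Set ℝ) : Prop :=
  (∀ t ∈ s, x t ∈ D) ∧ IsIntegralCurveOn x (fun _ => F) s

/-- Local asymptotic stability of the point `e` for the ODE `x' = F x` on `D`: solutions starting
near `e` exist for all future times, `e` is Lyapunov stable, and `e` is locally attractive. -/
structure IsLocallyAsymptoticallyStable {E : Type*} [NormedAddCommGroup E] [NormedSpace ℝ E]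
    (F : E → E) (D : Set E) (e : E) : Prop where
  /-- Every initial value near `e` has a solution defined for all `t ≥ 0`. -/
  exists_solution : ∃ δ > 0, ∀ x₀ ∈ Metric.ball e δ,
    ∃ x : ℝ → E, x 0 = x₀ ∧ IsODESolutionOn F D x (Set.Ici 0)
  /-- Lyapunov stability. It is required of all solutions, on whatever interval `[0, T)`. -/
  stable : ∀ ε > 0, ∃ δ > 0, ∀ (T : ℝ) (x : ℝ → E), x 0 ∈ Metric.ball e δ →
    IsODESolutionOn F D x (Set.Ico 0 T) → ∀ t ∈ Set.Ico 0 T, x t ∈ Metric.ball e ε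
  /-- Local attractivity. -/
  attractive : ∃ δ > 0, ∀ x : ℝ → E, x 0 ∈ Metric.ball e δ →
    IsODESolutionOn F D x (Set.Ici 0) → Filter.Tendsto x Filter.atTop (nhds e)

/-- The data of the viewer/quality model with `N` streamers. -/
structure StreamingModel (N : ℕ) where
  /-- intrinsic attractiveness of each streamer -/
  α : Fin N → ℝ
  /-- price of each streamer -/
  p : Fin N → ℝ
  /-- network-effect parameter -/
  β : ℝ
  /-- total number of viewers -/
  M : ℝ
  /-- commission rate -/
  τ : ℝ
  /-- average revenue per viewer -/
  R : ℝ
  /-- adjustment rate of the viewers -/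
  γ : ℝ
  /-- adjustment rate of the quality of each streamer -/
  η : Fin N → ℝ
  /-- admissible quality levels, for instance `(0, ∞)` or all of `ℝ` -/
  Q : Set ℝ
  /-- cost of quality; only its values on `Q` matter -/
  c : ℝ → ℝ
  isOpen_Q : IsOpen Q
  contDiffOn_c : ContDiffOn ℝ 2 c Q

namespace StreamingModel

noncomputable section

variable {N : ℕ} (m : StreamingModel N)

/-- The multinomial logit probability `P_i` of choosing streamer `i`, given the viewer numbers `n`
and the qualities `q`. -/
def choiceProb (n q : Fin N → ℝ) (i : Fin N) : ℝ :=
  Real.exp (m.α i * q i - m.p i + m.β * n i) /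
    ∑ k, Real.exp (m.α k * q k - m.p k + m.β * n k)

/-- The marginal audience `∂n_i/∂q_i`: the partial derivative of `M * P_i` with respect to `q_i`,
all other variables being fixed. -/
def marginalAudience (n q : Fin N → ℝ) (i : Fin N) : ℝ :=
  deriv (fun s => m.M * m.choiceProb n (Function.update q i s) i) (q i)

/-- Right-hand side of the equation for `dn_i/dt`. -/
def viewerRate (n q : Fin N → ℝ) (i : Fin N) : ℝ :=
  m.γ * (m.M * m.choiceProb n q i - n i)

/-- Right-hand side of the equation for `dq_i/dt`. -/
def qualityRate (n q : Fin N → ℝ) (i : Fin N) : ℝ :=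
  m.η i * ((1 - m.τ) * m.R * m.marginalAudience n q i - deriv m.c (q i))

/-- The vector field of the coupled system on states `(n, q)`. -/
def vectorField (x : (Fin N → ℝ) × (Fin N → ℝ)) : (Fin N → ℝ) × (Fin N → ℝ) :=
  (m.viewerRate x.1 x.2, m.qualityRate x.1 x.2)

/-- The states: all qualities are admissible. -/
def stateSpace : Set ((Fin N → ℝ) × (Fin N → ℝ)) :=
  {x | ∀ i, x.2 i ∈ m.Q}

/-- Steady states are the rest points of the coupled system. -/
def IsSteadyState (x : (Fin N → ℝ) × (Fin N → ℝ)) : Prop :=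
  x ∈ m.stateSpace ∧ m.vectorField x = 0

/-- The `2N × 2N` Jacobian matrix of the coupled system at the state `(n, q)`: the blocks of partial
derivatives `∂(dn_i/dt)/∂n_j`, `∂(dn_i/dt)/∂q_j`, `∂(dq_i/dt)/∂n_j`, `∂(dq_i/dt)/∂q_j`. -/
def jacobian (n q : Fin N → ℝ) : Matrix (Fin N ⊕ Fin N) (Fin N ⊕ Fin N) ℝ :=
  Matrix.fromBlocks
    (Matrix.of fun i j => deriv (fun s => m.viewerRate (Function.update n j s) q i) (n j))
    (Matrix.of fun i j => deriv (fun s => m.viewerRate n (Function.update q j s) i) (q j))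
    (Matrix.of fun i j => deriv (fun s => m.qualityRate (Function.update n j s) q i) (n j))
    (Matrix.of fun i j => deriv (fun s => m.qualityRate n (Function.update q j s) i) (q j))

end

end StreamingModel

open Set Filter Topology
open scoped Matrix

/-! ### Lyapunov forms for matrices with spectrum in the open left half-plane -/

section LyapunovForm

/-! Lyapunov's direct method. If the spectrum of the linearisation lies in the open left half-plane,
some positive definite quadratic form V decays exponentially along the linear flow.
`Module.End.exists_lyapunovForm` builds it by induction on dimension: the kernel of a left
eigenvector φ is an invariant hyperplane, and a large multiple of |φ|² added to the form on it
absorbs the coupling. The field is C¹ and vanishes at the steady state, so near it the linearisation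
error costs at most half the decay rate (`exists_ball_forall_lyapunov_le`). Small sublevel sets of V
are then forward invariant and V decays exponentially on them (`IsIntegralCurveOn.lyapunov_le`),
which gives stability and attraction for every solution, without appeal to uniqueness. A uniform
local existence time on such a set gives solutions for all t ≥ 0. -/

/-- Young's inequality for a positive definite symmetric bilinear form. -/
theorem LinearMap.BilinForm.two_mul_mul_apply_le {V : Type*} [AddCommGroup V] [Module ℝ V]
    (B : V →ₗ[ℝ] V →ₗ[ℝ] ℝ) (hsymm : ∀ v w, B v w = B w v) (hpos : ∀ v, v ≠ 0 → 0 < B v v)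
    (c : ℝ) (v w : V) : 2 * c * B v w ≤ c ^ 2 * B v v + B w w := by
  have h : 0 ≤ B (c • v - w) (c • v - w) := by
    by_cases h0 : c • v - w = 0
    · simp [h0]
    · exact (hpos _ h0).le
  simp only [map_sub, map_smul, LinearMap.sub_apply, LinearMap.smul_apply, smul_eq_mul,
    hsymm w v] at h
  linarith

/-- The real part of the Hermitian form `conj z * w` on `ℂ`, as a real bilinear form. -/
noncomputable def Complex.realInnerForm : ℂ →ₗ[ℝ] ℂ →ₗ[ℝ] ℝ :=
  LinearMap.mk₂ ℝ (fun z w => z.re * w.re + z.im * w.im)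
    (fun _ _ _ => by simp; ring) (fun _ _ _ => by simp; ring)
    (fun _ _ _ => by simp; ring) (fun _ _ _ => by simp; ring)

theorem Complex.realInnerForm_apply (z w : ℂ) :
    Complex.realInnerForm z w = z.re * w.re + z.im * w.im := rfl

/-- An endomorphism of a nontrivial finite-dimensional complex space has a left eigenvector, whose
eigenvalue is also an eigenvalue of the endomorphism itself. -/
theorem Module.End.exists_dual_eigenvector {V : Type*} [AddCommGroup V] [Module ℂ V]
    [FiniteDimensional ℂ V] [Nontrivial V] (T : Module.End ℂ V) :
    ∃ (μ : ℂ) (φ : Module.Dual ℂ V), T.HasEigenvalue μ ∧ φ ≠ 0 ∧ ∀ v, φ (T v) = μ * φ v := by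
  obtain ⟨μ, hμ⟩ := Module.End.exists_eigenvalue T
  -- In finite dimension T - μ, not being injective, is not surjective; a functional killing its
  -- range is a left eigenvector.
  have hns : LinearMap.range (T - algebraMap ℂ (Module.End ℂ V) μ) ≠ ⊤ := by
    intro htop
    have hker := LinearMap.ker_eq_bot_iff_range_eq_top.mpr htop
    rw [Module.End.hasEigenvalue_iff, Module.End.eigenspace_def] at hμ
    exact hμ hker
  obtain ⟨φ, hφ, hle⟩ := Submodule.exists_le_ker_of_lt_top _ (lt_top_iff_ne_top.mpr hns)
  refine ⟨μ, φ, hμ, hφ, fun v => ?_⟩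
  have := hle (LinearMap.mem_range_self _ v)
  simpa [sub_eq_zero] using this

/-- If all eigenvalues of `T` have negative real part, there is an inner product for which `T` is
strictly dissipative. -/
theorem Module.End.exists_lyapunovForm {V : Type*} [AddCommGroup V] [Module ℂ V] [Module ℝ V]
    [IsScalarTower ℝ ℂ V] [FiniteDimensional ℂ V] (T : Module.End ℂ V)
    (hT : ∀ μ, T.HasEigenvalue μ → μ.re < 0) :
    ∃ B : V →ₗ[ℝ] V →ₗ[ℝ] ℝ, (∀ v w, B v w = B w v) ∧ (∀ v, v ≠ 0 → 0 < B v v) ∧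
      ∃ c > 0, ∀ v, B v (T v) ≤ -c * B v v := by
  induction hd : Module.finrank ℂ V using Nat.strong_induction_on generalizing V with
  | _ d ih =>
  rcases subsingleton_or_nontrivial V with hV | hV
  · exact ⟨0, by simp, fun v hv => (hv (Subsingleton.elim _ _)).elim, 1, one_pos, by simp⟩
  obtain ⟨μ, φ, hμ, hφ, hφT⟩ := T.exists_dual_eigenvector
  have hμ := hT μ hμ
  set W := LinearMap.ker φ with hW
  have hWT : ∀ w ∈ W, T w ∈ W := fun w hw => by
    rw [hW, LinearMap.mem_ker] at hw ⊢
    rw [hφT, hw, mul_zero]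
  have hWlt : Module.finrank ℂ W < d := by
    rw [← hd]
    refine Submodule.finrank_lt (s := W) ?_
    rwa [Ne, hW, LinearMap.ker_eq_top]
  obtain ⟨B, hsymm, hpos, c, hc, hdiss⟩ := ih _ hWlt (T.restrict hWT) (by
    intro ν hν
    obtain ⟨w, hw⟩ := hν.exists_hasEigenvector
    refine hT ν (Module.End.hasEigenvalue_of_hasEigenvector (x := (w : V)) ?_)
    rw [Module.End.hasEigenvector_iff, Module.End.mem_eigenspace_iff]
    refine ⟨?_, by simpa using hw.2⟩
    simpa using congrArg Subtype.val hw.apply_eq_smul) rfl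
  obtain ⟨u, hu⟩ : ∃ u, φ u = 1 := by
    obtain ⟨v, hv⟩ := DFunLike.ne_iff.mp hφ
    exact ⟨(φ v)⁻¹ • v, by simpa using inv_mul_cancel₀ (by simpa using hv)⟩
  let π : V →ₗ[ℂ] W :=
    LinearMap.codRestrict W (LinearMap.id - φ.smulRight u) (by intro v; simp [hW, hu])
  have hπ : ∀ v, (π v : V) = v - φ v • u := fun v => rfl
  set r : W := π (T u) with hr
  -- T is block triangular for V = W ⊕ ℂu; r is the coupling term.
  have hπT : ∀ v, π (T v) = T.restrict hWT (π v) + φ v • r := by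
    intro v
    ext
    simp only [hπ, hr, Submodule.coe_add, Submodule.coe_smul, LinearMap.coe_restrict_apply,
      hφT, map_sub, map_smul, hu]
    module
  -- B is only real bilinear, so z • r is split along r and i • r; the factor 2 pays for the cross
  -- term.
  set C : ℝ := 2 * B r r + 2 * B (Complex.I • r) (Complex.I • r) with hC
  have hnn : ∀ w, 0 ≤ B w w := fun w => by
    by_cases h0 : w = 0
    · simp [h0]
    · exact (hpos _ h0).le
  have hC0 : 0 ≤ C := by have := hnn r; have := hnn (Complex.I • r); positivity
  have hCz : ∀ z : ℂ, B (z • r) (z • r) ≤ C * (z.re * z.re + z.im * z.im) := by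
    intro z
    have hz : z • r = z.re • r + z.im • (Complex.I • r) := by
      conv_lhs => rw [← Complex.re_add_im z]
      rw [add_smul, mul_smul, ← Complex.coe_algebraMap, algebraMap_smul, algebraMap_smul]
    have h1 := LinearMap.BilinForm.two_mul_mul_apply_le B hsymm hpos 1 (z.re • r)
      (z.im • (Complex.I • r))
    rw [hz]
    simp only [map_add, LinearMap.add_apply, map_smul, LinearMap.smul_apply, smul_eq_mul] at h1 ⊢
    rw [hsymm (Complex.I • r) r]
    nlinarith [mul_nonneg (mul_self_nonneg z.re) (hnn (Complex.I • r)),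
      mul_nonneg (mul_self_nonneg z.im) (hnn r)]
  -- Young's inequality bounds the coupling by half the decay on W plus C/(2c)·|φ v|². This K makes
  -- the φ part outweigh the latter with |φ v|² to spare, whence the rate min (c/2) K⁻¹.
  set K : ℝ := (C / (2 * c) + 1) / (-μ.re) with hK
  have hKpos : 0 < K := by have : 0 < -μ.re := by linarith
                           positivity
  have hKμ : K * μ.re = -(C / (2 * c) + 1) := by
    rw [hK]; field_simp [hμ.ne]
  let φR : V →ₗ[ℝ] ℂ := φ.restrictScalars ℝ
  let πR : V →ₗ[ℝ] W := π.restrictScalars ℝ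
  refine ⟨B.compl₁₂ πR πR + K • Complex.realInnerForm.compl₁₂ φR φR, ?_, ?_, min (c / 2) K⁻¹,
    by positivity, ?_⟩
  · intro v w
    simp [Complex.realInnerForm_apply, hsymm (πR v) (πR w), mul_comm]
  · intro v hv
    simp only [LinearMap.add_apply, LinearMap.smul_apply, LinearMap.compl₁₂_apply, smul_eq_mul,
      Complex.realInnerForm_apply]
    by_cases h0 : φ v = 0
    · have : π v ≠ 0 := fun h => hv (by simpa [hπ, h0] using congrArg Subtype.val h)
      have h1 : φR v = 0 := h0
      have h2 : 0 < B (πR v) (πR v) := hpos _ this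
      simpa [h1] using h2
    · have h1 : 0 < Complex.normSq (φ v) := Complex.normSq_pos.mpr h0
      rw [Complex.normSq_apply] at h1
      have h2 : 0 < K * ((φR v).re * (φR v).re + (φR v).im * (φR v).im) := mul_pos hKpos h1
      have := hnn (πR v)
      linarith
  · intro v
    simp only [LinearMap.add_apply, LinearMap.smul_apply, LinearMap.compl₁₂_apply, smul_eq_mul,
      Complex.realInnerForm_apply]
    change B (π v) (π (T v)) + K * ((φ v).re * (φ (T v)).re + (φ v).im * (φ (T v)).im) ≤
      -min (c / 2) K⁻¹ * (B (π v) (π v) + K * ((φ v).re * (φ v).re + (φ v).im * (φ v).im))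
    rw [hπT, hφT, map_add, Complex.mul_re, Complex.mul_im]
    have h1 := hdiss (π v)
    have h2 := LinearMap.BilinForm.two_mul_mul_apply_le B hsymm hpos c (π v) (φ v • r)
    have h3 := hCz (φ v)
    set s := (φ v).re * (φ v).re + (φ v).im * (φ v).im with hs
    have hs0 : 0 ≤ s := add_nonneg (mul_self_nonneg _) (mul_self_nonneg _)
    have h4 : B (π v) (φ v • r) ≤ c / 2 * B (π v) (π v) + C / (2 * c) * s := by
      have : 2 * c * B (π v) (φ v • r) ≤ 2 * c * (c / 2 * B (π v) (π v) + C / (2 * c) * s) := by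
        refine (h2.trans (add_le_add_right h3 _)).trans (le_of_eq ?_)
        field_simp
      exact le_of_mul_le_mul_left this (by positivity)
    have h5 : K * ((φ v).re * (μ.re * (φ v).re - μ.im * (φ v).im) +
        (φ v).im * (μ.re * (φ v).im + μ.im * (φ v).re)) = -(C / (2 * c) + 1) * s := by
      rw [← hKμ, hs]; ring
    have h6 : min (c / 2) K⁻¹ * B (π v) (π v) ≤ c / 2 * B (π v) (π v) :=
      mul_le_mul_of_nonneg_right (min_le_left _ _) (hnn _)
    have h7 : min (c / 2) K⁻¹ * (K * s) ≤ s := by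
      calc _ ≤ K⁻¹ * (K * s) := mul_le_mul_of_nonneg_right (min_le_right _ _) (by positivity)
        _ = s := by field_simp
    rw [h5]
    linarith

/-- Matrix version: a real matrix whose complex eigenvalues have negative real part is strictly
dissipative for some inner product. -/
theorem Matrix.exists_lyapunovForm {ι : Type*} [Fintype ι] [DecidableEq ι] (A : Matrix ι ι ℝ)
    (hA : ∀ μ : ℂ, Module.End.HasEigenvalue (Matrix.toLin' (A.map (algebraMap ℝ ℂ))) μ →
      μ.re < 0) :
    ∃ B : (ι → ℝ) →ₗ[ℝ] (ι → ℝ) →ₗ[ℝ] ℝ, (∀ v w, B v w = B w v) ∧ (∀ v, v ≠ 0 → 0 < B v v) ∧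
      ∃ c > 0, ∀ v, B v (A *ᵥ v) ≤ -c * B v v := by
  obtain ⟨B, hsymm, hpos, c, hc, hdiss⟩ := Module.End.exists_lyapunovForm _ hA
  let j : (ι → ℝ) →ₗ[ℝ] (ι → ℂ) := (Algebra.linearMap ℝ ℂ).compLeft ι
  have hj : ∀ v i, j v i = algebraMap ℝ ℂ (v i) := fun _ _ => rfl
  have hjA : ∀ v, Matrix.toLin' (A.map (algebraMap ℝ ℂ)) (j v) = j (A *ᵥ v) := by
    intro v
    ext i
    simp [hj, Matrix.mulVec, dotProduct]
  refine ⟨B.compl₁₂ j j, fun v w => hsymm _ _, fun v hv => hpos _ fun h => hv ?_, c, hc,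
    fun v => ?_⟩
  · ext i
    simpa [hj] using congrFun h i
  · have := hdiss (j v)
    rwa [hjA] at this

end LyapunovForm

/-! ### Gluing integral curves -/

section Curves

variable {E : Type*} [NormedAddCommGroup E] [NormedSpace ℝ E]

/-- Integral curves on two closed sets of times glue. -/
theorem IsIntegralCurveOn.union {γ : ℝ → E} {v : ℝ → E → E} {s s' : Set ℝ}
    (h : IsIntegralCurveOn γ v s) (h' : IsIntegralCurveOn γ v s') (hs : IsClosed s)
    (hs' : IsClosed s') : IsIntegralCurveOn γ v (s ∪ s') := by
  -- Off a closed set the derivative within it is unconstrained, so both one-sided statements hold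
  -- at every time and can be united.
  have key : ∀ {u : Set ℝ}, IsIntegralCurveOn γ v u → IsClosed u → ∀ t,
      HasDerivWithinAt γ (v t (γ t)) u t := by
    intro u hu huc t
    by_cases ht : t ∈ u
    · exact hu t ht
    · exact HasFDerivWithinAt.of_notMem_closure (by rwa [huc.closure_eq])
  exact fun t _ => (key h hs t).union (key h' hs' t)

/-- If every point of `S` is the start of an integral curve in `S` over a time interval of fixed
length, then every point of `S` is the start of an integral curve in `S` for all future times. -/
theorem exists_isIntegralCurveOn_Ici {F : E → E} {S : Set E} {h : ℝ} (hh : 0 < h)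
    (hS : ∀ x ∈ S, ∃ y : ℝ → E, y 0 = x ∧ (∀ t ∈ Icc 0 h, y t ∈ S) ∧
      IsIntegralCurveOn y (fun _ => F) (Icc 0 h)) {x₀ : E} (hx₀ : x₀ ∈ S) :
    ∃ x : ℝ → E, x 0 = x₀ ∧ (∀ t ∈ Ici 0, x t ∈ S) ∧ IsIntegralCurveOn x (fun _ => F) (Ici 0) := by
  choose! φ hφ0 hφS hφ using hS
  let a : ℕ → E := fun k => (fun z => φ z h)^[k] x₀
  have ha_succ : ∀ k, a (k + 1) = φ (a k) h := fun k => Function.iterate_succ_apply' _ _ _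
  have haS : ∀ k, a k ∈ S := by
    intro k
    induction k with
    | zero => exact hx₀
    | succ k ih => rw [ha_succ]; exact hφS _ ih _ ⟨hh.le, le_rfl⟩
  -- At t = k * h the floor already selects the next piece, which starts where the previous one
  -- ends.
  let x : ℝ → E := fun t => φ (a ⌊t / h⌋₊) (t - ⌊t / h⌋₊ * h)
  have hx : ∀ k : ℕ, ∀ t ∈ Icc (k * h) ((k + 1) * h), x t = φ (a k) (t - k * h) := by
    intro k t ht
    rcases ht.2.lt_or_eq with hlt | heq
    · have : ⌊t / h⌋₊ = k := by
        rw [Nat.floor_eq_iff (div_nonneg ((by positivity : 0 ≤ k * h).trans ht.1) hh.le)]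
        exact ⟨(le_div_iff₀ hh).mpr ht.1, (div_lt_iff₀ hh).mpr hlt⟩
      simp only [x, this]
    · have : ⌊t / h⌋₊ = k + 1 := by
        rw [heq, mul_div_cancel_right₀ _ hh.ne']
        exact_mod_cast Nat.floor_natCast (k + 1)
      simp only [x, this]
      rw [heq, Nat.cast_add, Nat.cast_one, sub_self, hφ0 _ (haS _), ha_succ]
      congr 1
      ring
  have hstep : ∀ k : ℕ, IsIntegralCurveOn x (fun _ => F) (Icc (k * h) ((k + 1) * h)) := by
    intro k t ht
    have hmaps : MapsTo (fun s : ℝ => s - k * h) (Icc (k * h) ((k + 1) * h)) (Icc 0 h) :=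
      fun s hs => ⟨by linarith [hs.1], by linarith [hs.2]⟩
    have h1 := (hφ (a k) (haS k) _ (hmaps ht)).scomp t
      (((hasDerivAt_id t).sub_const (k * h)).hasDerivWithinAt) hmaps
    rw [one_smul] at h1
    rw [hx k t ht]
    exact h1.congr (fun s hs => hx k s hs) (hx k t ht)
  have hIcc : ∀ k : ℕ, IsIntegralCurveOn x (fun _ => F) (Icc 0 (k * h)) := by
    intro k
    induction k with
    | zero => exact (hstep 0).mono fun t ht => ⟨by simpa using ht.1, by
        have := ht.2; simp at this ⊢; linarith⟩
    | succ k ih =>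
      have := ih.union (hstep k) isClosed_Icc isClosed_Icc
      rw [Icc_union_Icc_eq_Icc (by positivity) (by nlinarith)] at this
      exact_mod_cast this
  have hnat : ∀ t : ℝ, ∃ k : ℕ, t < k * h := fun t => by
    obtain ⟨k, hk⟩ := exists_nat_gt (t / h)
    exact ⟨k, (div_lt_iff₀ hh).mp hk⟩
  refine ⟨x, by simpa [x, a] using hφ0 x₀ hx₀, fun t ht => ?_, fun t ht => ?_⟩
  · have h0 : (0 : ℝ) ≤ t / h := div_nonneg ht hh.le
    have h1 := (le_div_iff₀ hh).mp (Nat.floor_le h0)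
    have h2 := (div_lt_iff₀ hh).mp (Nat.lt_floor_add_one (t / h))
    exact hφS _ (haS _) _ ⟨by linarith, by linarith⟩
  · obtain ⟨k, hk⟩ := hnat t
    exact (hIcc k t ⟨ht, hk.le⟩).mono_of_mem_nhdsWithin
      (inter_mem_nhdsWithin (Ici 0) (Iic_mem_nhds hk))

end Curves

/-! ### From a quadratic Lyapunov function to asymptotic stability -/

section LyapunovStability

variable {E : Type*} [NormedAddCommGroup E] [NormedSpace ℝ E]

/-- A continuous positive definite bilinear form on a finite-dimensional space is coercive. -/
theorem ContinuousLinearMap.exists_coercive [FiniteDimensional ℝ E] (P : E →L[ℝ] E →L[ℝ] ℝ)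
    (hpos : ∀ v, v ≠ 0 → 0 < P v v) : ∃ m > 0, ∀ v, m * ‖v‖ ^ 2 ≤ P v v := by
  obtain ⟨m, hm, hle⟩ := (isCompact_sphere (0 : E) 1).exists_forall_le' (f := fun v => P v v)
    (a := 0) (by fun_prop) (fun v hv => hpos v (by rintro rfl; simp at hv))
  refine ⟨m, hm, fun v => ?_⟩
  rcases eq_or_ne v 0 with rfl | hv
  · simp
  have hn : 0 < ‖v‖ := norm_pos_iff.mpr hv
  have h := hle (‖v‖⁻¹ • v) (by simp [norm_smul, hn.ne'])
  simp only [map_smul, smul_apply, smul_eq_mul] at h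
  calc m * ‖v‖ ^ 2 ≤ (‖v‖⁻¹ * (‖v‖⁻¹ * P v v)) * ‖v‖ ^ 2 := by gcongr
    _ = P v v := by field_simp

/-- A quadratic Lyapunov function for the derivative at a rest point is one for the vector field
near the rest point. -/
theorem exists_ball_forall_lyapunov_le {F : E → E} {e : E} {A : E →L[ℝ] E}
    (hF : HasFDerivAt F A e) (he : F e = 0) {P : E →L[ℝ] E →L[ℝ] ℝ} {m c : ℝ} (hm : 0 < m)
    (hc : 0 < c) (hP : ∀ v, m * ‖v‖ ^ 2 ≤ P v v) (hA : ∀ v, P v (A v) ≤ -c * P v v) :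
    ∃ r > 0, ∀ x ∈ Metric.ball e r, P (x - e) (F x) ≤ -(c / 2) * P (x - e) (x - e) := by
  -- Chosen so that the linearisation error contributes at most (c/2)·m·‖x - e‖²; the + 1 covers P =
  -- 0.
  have hη : 0 < c * m / (2 * (‖P‖ + 1)) := by positivity
  have h := hF.isLittleO.def hη
  obtain ⟨r, hr, hball⟩ := Metric.eventually_nhds_iff_ball.mp h
  refine ⟨r, hr, fun x hx => ?_⟩
  have h1 := hball x hx
  rw [he, sub_zero] at h1
  have h2 : P (x - e) (F x - A (x - e)) ≤ c / 2 * P (x - e) (x - e) := by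
    calc P (x - e) (F x - A (x - e)) ≤ ‖P (x - e) (F x - A (x - e))‖ := Real.le_norm_self _
      _ ≤ ‖P‖ * ‖x - e‖ * ‖F x - A (x - e)‖ := P.le_opNorm₂ _ _
      _ ≤ (‖P‖ + 1) * ‖x - e‖ * (c * m / (2 * (‖P‖ + 1)) * ‖x - e‖) := by
        gcongr
        linarith
      _ = c / 2 * (m * ‖x - e‖ ^ 2) := by field_simp
      _ ≤ c / 2 * P (x - e) (x - e) := by
        gcongr
        exact hP _
  have h3 := hA (x - e)
  rw [map_sub] at h2
  linarith

/-- Exponential decay of a quadratic Lyapunov function along integral curves that start in a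
sublevel set on which it is known to decrease. -/
theorem IsIntegralCurveOn.lyapunov_le {F : E → E} {e : E} {P : E →L[ℝ] E →L[ℝ] ℝ} {m k r : ℝ}
    (hm : 0 < m) (hk : 0 < k) (hr : 0 < r) (hsymm : ∀ v w, P v w = P w v)
    (hP : ∀ v, m * ‖v‖ ^ 2 ≤ P v v)
    (hF : ∀ x ∈ Metric.ball e r, P (x - e) (F x) ≤ -k * P (x - e) (x - e))
    {x : ℝ → E} {T C : ℝ} (hx : IsIntegralCurveOn x (fun _ => F) (Icc 0 T))
    (hx0 : P (x 0 - e) (x 0 - e) < C) (hC : C < m * r ^ 2) :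
    ∀ t ∈ Icc 0 T, P (x t - e) (x t - e) ≤ C * Real.exp (-k * t) := by
  have hC0 : 0 < C := lt_of_le_of_lt (le_trans (by positivity) (hP _)) hx0
  have hder : ∀ t ∈ Icc 0 T, HasDerivWithinAt (fun t => P (x t - e) (x t - e))
      (2 * P (x t - e) (F (x t))) (Icc 0 T) t := by
    intro t ht
    have h1 : HasDerivWithinAt (fun t => x t - e) (F (x t)) (Icc 0 T) t := (hx t ht).sub_const e
    have h2 := (P.hasFDerivAt.comp_hasDerivWithinAt t h1).clm_apply h1
    refine h2.congr_deriv ?_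
    rw [hsymm (F (x t)), two_mul]
    rfl
  -- Barrier argument: derivatives are compared only where V meets C·exp(-kt). There V < m r² puts x
  -- t in the ball, and V' ≤ -2kV < -kV, the barrier's slope.
  refine image_le_of_deriv_right_lt_deriv_boundary (f := fun t => P (x t - e) (x t - e))
    (f' := fun t => 2 * P (x t - e) (F (x t)))
    (B := fun t => C * Real.exp (-k * t)) (B' := fun t => C * (Real.exp (-k * t) * (-k)))
    (fun t ht => (hder t ht).continuousWithinAt) (fun t ht => ?_) (by simpa using hx0.le)
    (fun t => ?_) (fun t ht heq => ?_)
  · exact (hder t ⟨ht.1, ht.2.le⟩).mono_of_mem_nhdsWithin (Icc_mem_nhdsGE_of_mem ht)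
  · have h1 : HasDerivAt (fun t => -k * t) (-k) t := by simpa using (hasDerivAt_id t).const_mul (-k)
    exact h1.exp.const_mul C
  · have hle : Real.exp (-k * t) ≤ 1 := Real.exp_le_one_iff.mpr (by nlinarith [ht.1])
    have hlt : m * ‖x t - e‖ ^ 2 < m * r ^ 2 := by
      have := hP (x t - e)
      have : C * Real.exp (-k * t) ≤ C * 1 := by gcongr
      linarith
    have hball : x t ∈ Metric.ball e r := by
      rw [mem_ball_iff_norm]
      exact lt_of_pow_lt_pow_left₀ 2 hr.le (lt_of_mul_lt_mul_left hlt hm.le)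
    have h1 := hF _ hball
    have h2 : 0 < C * Real.exp (-k * t) := by positivity
    rw [heq] at h1
    nlinarith

/-- A rest point at which the derivative of the vector field admits a quadratic Lyapunov function
is locally asymptotically stable. -/
theorem isLocallyAsymptoticallyStable_of_lyapunovForm [FiniteDimensional ℝ E] {F : E → E}
    {D : Set E} {e : E} (hD : D ∈ 𝓝 e) (hF : ContDiffAt ℝ 1 F e) (he : F e = 0)
    {P : E →L[ℝ] E →L[ℝ] ℝ} (hsymm : ∀ v w, P v w = P w v) (hpos : ∀ v, v ≠ 0 → 0 < P v v)
    {c : ℝ} (hc : 0 < c) (hA : ∀ v, P v (fderiv ℝ F e v) ≤ -c * P v v) :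
    IsLocallyAsymptoticallyStable F D e := by
  have : CompleteSpace E := FiniteDimensional.complete ℝ E
  obtain ⟨m, hm, hP⟩ := P.exists_coercive hpos
  obtain ⟨r, hr, hball⟩ := exists_ball_forall_lyapunov_le
    (hF.differentiableAt one_ne_zero).hasFDerivAt he hm hc hP hA
  set k := c / 2 with hk
  have hk0 : 0 < k := by positivity
  have hcont : Continuous fun x => P (x - e) (x - e) := by fun_prop
  have hnear : ∀ C > 0, ∃ δ > 0, ∀ x ∈ Metric.ball e δ, P (x - e) (x - e) < C := by
    intro C hC
    refine Metric.eventually_nhds_iff_ball.mp (hcont.continuousAt.eventually_lt_const ?_)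
    simpa using hC
  have hfar : ∀ ρ > 0, ∀ x, P (x - e) (x - e) < m * ρ ^ 2 → x ∈ Metric.ball e ρ := by
    intro ρ hρ x hx
    rw [mem_ball_iff_norm]
    exact lt_of_pow_lt_pow_left₀ 2 hρ.le (lt_of_mul_lt_mul_left ((hP _).trans_lt hx) hm.le)
  have hexp : ∀ t : ℝ, 0 ≤ t → Real.exp (-k * t) ≤ 1 := fun t ht =>
    Real.exp_le_one_iff.mpr (by nlinarith)
  have hinv : ∀ {C T : ℝ} {x : ℝ → E}, C ≤ m * r ^ 2 →
      IsIntegralCurveOn x (fun _ => F) (Icc 0 T) → P (x 0 - e) (x 0 - e) < C →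
      ∀ t ∈ Icc 0 T, P (x t - e) (x t - e) < C := by
    intro C T x hC hx hx0 t ht
    obtain ⟨C', h1, h2⟩ := exists_between hx0
    have hC' : 0 < C' := lt_of_le_of_lt (le_trans (by positivity) (hP _)) h1
    refine lt_of_le_of_lt ((hx.lyapunov_le hm hk0 hr hsymm hP hball h1 (h2.trans_le hC) t ht).trans
      ?_) h2
    exact mul_le_of_le_one_right hC'.le (hexp t ht.1)
  refine ⟨?_, ?_, ?_⟩
  · obtain ⟨ρ, hρ, h, hh, hex⟩ :=
      hF.exists_forall_mem_closedBall_exists_eq_forall_mem_Ioo_hasDerivAt 0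
    obtain ⟨d, hd, hdD⟩ := Metric.mem_nhds_iff.mp hD
    have hs : 0 < min r (min ρ d) := by positivity
    -- The sublevel set V < C lies in three balls at once: decay (r), uniform existence time (ρ),
    -- and the domain (d).
    set C := m * (min r (min ρ d)) ^ 2 with hC
    obtain ⟨δ, hδ, hδC⟩ := hnear C (by positivity)
    refine ⟨δ, hδ, fun x₀ hx₀ => ?_⟩
    have hCr : C ≤ m * r ^ 2 := by
      rw [hC]; gcongr; exact min_le_left _ _
    obtain ⟨x, hx0, hxS, hx⟩ := exists_isIntegralCurveOn_Ici (F := F)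
      (S := {x | P (x - e) (x - e) < C}) (half_pos hh) (by
        intro x hx
        have hxρ := hfar _ hs x hx
        obtain ⟨y, hy0, hy⟩ := hex x (Metric.ball_subset_closedBall
          (Metric.ball_subset_ball ((min_le_right _ _).trans (min_le_left _ _)) hxρ))
        have hyI : IsIntegralCurveOn y (fun _ => F) (Icc 0 (h / 2)) := fun t ht =>
          (hy t ⟨by linarith [ht.1], by linarith [ht.2]⟩).hasDerivWithinAt
        refine ⟨y, hy0, hinv hCr hyI (by simpa [hy0] using hx), hyI⟩) (hδC x₀ hx₀)
    exact ⟨x, hx0, fun t ht => hdD (Metric.ball_subset_ball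
      ((min_le_right _ _).trans (min_le_right _ _)) (hfar _ hs _ (hxS t ht))), hx⟩
  · intro ε hε
    have hs : 0 < min r ε := by positivity
    obtain ⟨δ, hδ, hδC⟩ := hnear (m * (min r ε) ^ 2) (by positivity)
    refine ⟨δ, hδ, fun T x hx0 hx t ht => ?_⟩
    have hxt : IsIntegralCurveOn x (fun _ => F) (Icc 0 t) :=
      hx.2.mono fun s hs => ⟨hs.1, hs.2.trans_lt ht.2⟩
    have := hinv (by gcongr; exact min_le_left _ _) hxt (hδC _ hx0) t ⟨ht.1, le_rfl⟩
    exact Metric.ball_subset_ball (min_le_right _ _) (hfar _ hs _ this)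
  -- Half the radius leaves the level strictly below m r², as the decay estimate requires.
  · obtain ⟨δ, hδ, hδC⟩ := hnear (m * (r / 2) ^ 2) (by positivity)
    refine ⟨δ, hδ, fun x hx0 hx => ?_⟩
    have hlt : m * (r / 2) ^ 2 < m * r ^ 2 := by gcongr; linarith
    have hdecay : ∀ t ∈ Ici (0 : ℝ), ‖x t - e‖ ^ 2 ≤ (r / 2) ^ 2 * Real.exp (-k * t) := by
      intro t ht
      have hxt : IsIntegralCurveOn x (fun _ => F) (Icc 0 t) := hx.2.mono Icc_subset_Ici_self
      have := (hP _).trans (hxt.lyapunov_le hm hk0 hr hsymm hP hball (hδC _ hx0) hlt t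
        ⟨ht, le_rfl⟩)
      rw [mul_assoc] at this
      exact le_of_mul_le_mul_left this hm
    have hexp0 : Tendsto (fun t : ℝ => (r / 2) ^ 2 * Real.exp (-k * t)) atTop (𝓝 0) := by
      have : Tendsto (fun t : ℝ => -k * t) atTop atBot :=
        tendsto_id.const_mul_atTop_of_neg (neg_lt_zero.mpr hk0)
      simpa using (Real.tendsto_exp_atBot.comp this).const_mul ((r / 2) ^ 2)
    have hsq : Tendsto (fun t => ‖x t - e‖ ^ 2) atTop (𝓝 0) :=
      tendsto_of_tendsto_of_tendsto_of_le_of_le' tendsto_const_nhds hexp0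
        (Eventually.of_forall fun t => by positivity)
        (eventually_atTop.mpr ⟨0, fun t ht => hdecay t ht⟩)
    rw [tendsto_iff_norm_sub_tendsto_zero]
    simpa [Real.sqrt_sq] using hsq.sqrt

end LyapunovStability

/-! ### Smoothness and Jacobian of the streaming model -/

/-- The derivative of a function of two tuples of variables, in terms of partial derivatives. -/
theorem fderiv_uncurry_apply_eq_sum {ι κ : Type*} [Fintype ι] [DecidableEq ι] [Fintype κ]
    [DecidableEq κ] {f : (ι → ℝ) → (κ → ℝ) → ℝ} {a : ι → ℝ} {b : κ → ℝ}
    {f' : (ι → ℝ) × (κ → ℝ) →L[ℝ] ℝ} (hf : HasFDerivAt (fun x => f x.1 x.2) f' (a, b))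
    (v : (ι → ℝ) × (κ → ℝ)) :
    f' v = ∑ j, deriv (fun s => f (Function.update a j s) b) (a j) * v.1 j +
      ∑ j, deriv (fun s => f a (Function.update b j s)) (b j) * v.2 j := by
  have h1 : ∀ j, deriv (fun s => f (Function.update a j s) b) (a j) = f' (Pi.single j 1, 0) := by
    intro j
    refine HasDerivAt.deriv ?_
    refine HasFDerivAt.comp_hasDerivAt_of_eq (a j) hf
      ((hasDerivAt_update a j (a j)).prodMk (hasDerivAt_const (a j) b)) ?_
    simp
  have h2 : ∀ j, deriv (fun s => f a (Function.update b j s)) (b j) = f' (0, Pi.single j 1) := by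
    intro j
    refine HasDerivAt.deriv ?_
    refine HasFDerivAt.comp_hasDerivAt_of_eq (b j) hf
      ((hasDerivAt_const (b j) a).prodMk (hasDerivAt_update b j (b j))) ?_
    simp
  have hv : v = ∑ j, v.1 j • (Pi.single j 1, 0) + ∑ j, v.2 j • (0, Pi.single j 1) := by
    ext i <;> simp [Prod.fst_sum, Prod.snd_sum, Finset.sum_apply, Pi.single_apply]
  conv_lhs => rw [hv]
  simp only [map_add, map_sum, map_smul, smul_eq_mul, h1, h2, mul_comm]

namespace StreamingModel

variable {N : ℕ} (m : StreamingModel N)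

theorem isOpen_stateSpace : IsOpen m.stateSpace := by
  simp only [stateSpace, ofPred_forall]
  exact isOpen_iInter_of_finite fun i => m.isOpen_Q.preimage (by fun_prop)

theorem contDiff_choiceProb {X : Type*} [NormedAddCommGroup X] [NormedSpace ℝ X] {k : WithTop ℕ∞}
    {n q : X → Fin N → ℝ} (hn : ∀ i, ContDiff ℝ k fun x => n x i)
    (hq : ∀ i, ContDiff ℝ k fun x => q x i) (i : Fin N) :
    ContDiff ℝ k fun x => m.choiceProb (n x) (q x) i := by
  have hexp : ∀ j, ContDiff ℝ k fun x =>
      Real.exp (m.α j * q x j - m.p j + m.β * n x j) := fun j =>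
    (((contDiff_const.mul (hq j)).sub contDiff_const).add (contDiff_const.mul (hn j))).exp
  refine (hexp i).div (ContDiff.sum fun j _ => hexp j) fun x => ?_
  exact (Finset.sum_pos (fun j _ => Real.exp_pos _) ⟨i, Finset.mem_univ i⟩).ne'

/-- Giving the varied quality its own coordinate makes the marginal audience a partial derivative of
a jointly C² map, evaluated along x ↦ (x, x.2 i). -/
theorem contDiff_marginalAudience (i : Fin N) :
    ContDiff ℝ 1 fun x : (Fin N → ℝ) × (Fin N → ℝ) => m.marginalAudience x.1 x.2 i := by
  let G : ((Fin N → ℝ) × (Fin N → ℝ)) × ℝ → ℝ := fun z =>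
    m.M * m.choiceProb z.1.1 (Function.update z.1.2 i z.2) i
  have hG : ContDiff ℝ 2 G := by
    refine contDiff_const.mul (m.contDiff_choiceProb (fun j => by fun_prop) (fun j => ?_) i)
    by_cases h : j = i
    · subst h; simpa using contDiff_snd
    · simp only [Function.update_of_ne h]; fun_prop
  have heq : (fun x : (Fin N → ℝ) × (Fin N → ℝ) => m.marginalAudience x.1 x.2 i) =
      fun x => fderiv ℝ G (x, x.2 i) (0, 1) := by
    ext x
    refine HasDerivAt.deriv ?_
    exact HasFDerivAt.comp_hasDerivAt (x.2 i) (hG.differentiable two_ne_zero _).hasFDerivAt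
      ((hasDerivAt_const (x.2 i) x).prodMk (hasDerivAt_id (x.2 i)))
  rw [heq]
  have hG' : ContDiff ℝ 1 (fderiv ℝ G) := hG.fderiv_right (by norm_num [one_add_one_eq_two])
  exact (hG'.comp (by fun_prop)).clm_apply contDiff_const

/-- The vector field is continuously differentiable on the state space. -/
theorem contDiffAt_vectorField {x : (Fin N → ℝ) × (Fin N → ℝ)} (hx : x ∈ m.stateSpace) :
    ContDiffAt ℝ 1 m.vectorField x := by
  refine ContDiffAt.prodMk (contDiffAt_pi.mpr fun i => ?_) (contDiffAt_pi.mpr fun i => ?_)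
  · have := m.contDiff_choiceProb (k := 1) (X := (Fin N → ℝ) × (Fin N → ℝ)) (n := Prod.fst)
      (q := Prod.snd) (fun j => by fun_prop) (fun j => by fun_prop) i
    exact (contDiff_const.mul ((contDiff_const.mul this).sub (by fun_prop))).contDiffAt
  · have hc : ContDiffAt ℝ 1 (deriv m.c) (x.2 i) :=
      (m.contDiffOn_c.deriv_of_isOpen m.isOpen_Q (by norm_num [one_add_one_eq_two])).contDiffAt
        (m.isOpen_Q.mem_nhds (hx i))
    have hc' : ContDiffAt ℝ 1 (fun y : (Fin N → ℝ) × (Fin N → ℝ) => deriv m.c (y.2 i)) x :=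
      hc.comp x (f := fun y : (Fin N → ℝ) × (Fin N → ℝ) => y.2 i) (by fun_prop)
    exact contDiffAt_const.mul
      ((contDiffAt_const.mul (m.contDiff_marginalAudience i).contDiffAt).sub hc')

/-- The matrix of the derivative of the vector field is the Jacobian matrix. -/
theorem sumElim_fderiv_vectorField {n q : Fin N → ℝ} (hx : (n, q) ∈ m.stateSpace)
    (v : (Fin N → ℝ) × (Fin N → ℝ)) :
    Sum.elim (fderiv ℝ m.vectorField (n, q) v).1 (fderiv ℝ m.vectorField (n, q) v).2 =
      m.jacobian n q *ᵥ Sum.elim v.1 v.2 := by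
  have hd := ((m.contDiffAt_vectorField hx).differentiableAt one_ne_zero).hasFDerivAt
  ext (i | i)
  · have h := fderiv_uncurry_apply_eq_sum (f := fun n q => m.viewerRate n q i)
      (hasFDerivAt_pi'.mp hd.fst i) v
    simpa [jacobian, Matrix.mulVec, dotProduct] using h
  · have h := fderiv_uncurry_apply_eq_sum (f := fun n q => m.qualityRate n q i)
      (hasFDerivAt_pi'.mp hd.snd i) v
    simpa [jacobian, Matrix.mulVec, dotProduct] using h

end StreamingModel

theorem theorem3 {N : ℕ} (m : StreamingModel N) (n q : Fin N → ℝ)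
    (hsteady : m.IsSteadyState (n, q))
    (hJ : ∀ μ : ℂ, Module.End.HasEigenvalue
      (Matrix.toLin' ((m.jacobian n q).map (algebraMap ℝ ℂ))) μ → μ.re < 0) :
    IsLocallyAsymptoticallyStable m.vectorField m.stateSpace (n, q) := by
  obtain ⟨B, hsymm, hpos, c, hc, hdiss⟩ := Matrix.exists_lyapunovForm _ hJ
  let L : ((Fin N → ℝ) × (Fin N → ℝ)) ≃ₗ[ℝ] (Fin N ⊕ Fin N → ℝ) :=
    (LinearEquiv.sumArrowLequivProdArrow (Fin N) (Fin N) ℝ ℝ).symm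
  have hL : ∀ v, L v = Sum.elim v.1 v.2 := fun v => rfl
  -- The form found for the Jacobian matrix, transported from sum-indexed vectors to pairs (n, q).
  let P : ((Fin N → ℝ) × (Fin N → ℝ)) →L[ℝ] ((Fin N → ℝ) × (Fin N → ℝ)) →L[ℝ] ℝ :=
    (B.compl₁₂ L.toLinearMap L.toLinearMap).toContinuousBilinearMap
  have hP : ∀ v w, P v w = B (L v) (L w) := fun v w => rfl
  refine isLocallyAsymptoticallyStable_of_lyapunovForm
    (m.isOpen_stateSpace.mem_nhds hsteady.1) (m.contDiffAt_vectorField hsteady.1) hsteady.2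
    (P := P) (fun v w => ?_) (fun v hv => ?_) hc fun v => ?_
  · rw [hP, hP, hsymm]
  · rw [hP]
    exact hpos _ (by simpa using hv)
  · rw [hP, hP, hL (fderiv ℝ _ _ v), m.sumElim_fderiv_vectorField hsteady.1]
    exact hdiss _
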